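/- For $k\in\mathbb N$ let $J(k)$ be the Johnson graph, whose vertex set is the set $\binom{\mathbb N}{k}$ of $k$-element subsets of $\mathbb N$, with an edge between $S$ and $T$ iff $|S\cap T|=k-1$. Structures are relational, with an arbitrary signature. Two structures on the same domain are called first-order interdefinable if every relation of each of them is first-order definable (without parameters) in the other. An $\omega$-categorical structure is called a model-complete core if all its endomorphisms preserve all first-order formulas. (Every structure that is first-order interdefinable with $J(k)$ is $\omega$-categorical.) A polymorphism of a structure $\mathfrak C$ with domain $C$ is a homomorphism $f\colon \mathfrak C^n\to \mathfrak C$ for some $n\in\mathbb N$; an operation $f\colon C^n\to C$ is called essentially unary if there are an index $i$ and a map $\alpha\colon C\to C$ with $f(x_1,\dots,x_n)=\alpha(x_i)$ for all $x_1,\dots,x_n\in C$. A clone on a set $A$ is a set of finitary operations on $A$ that contains all projections and is closed under composition. For a permutation group $G$ on $A$ let $\overline G$ be the closure of $G$ in $A^A$ in the topology of pointwise convergence ($A$ discrete); $G$ is called collapsing if the only clone on $A$ whose unary operations are exactly the elements of $\overline G$ is the clone generated by $\overline G$. **Theorem.** Let $k\ge 2$. 1. If $\mathfrak C$ is a model-complete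 core that is first-order interdefinable with $J(k)$, then every polymorphism of $\mathfrak C$ is essentially unary. 2. The automorphism group $\mathrm{Aut}(J(k))$, as a permutation group on $\binom{\mathbb N}{k}$, is collapsing. -/

import Mathlib

universe u v

namespace JohnsonCollapse

open FirstOrder FirstOrder.Language

/-- The Johnson graph on the `k`-element subsets of `ℕ`: two sets are adjacent iff their
intersection has exactly `k - 1` elements (written without truncated subtraction). -/
def johnsonGraph (k : ℕ) : SimpleGraph (Set.powersetCard ℕ k) where
  Adj S T := ((S : Finset ℕ) ∩ (T : Finset ℕ)).card + 1 = k
  symm := ⟨fun S T h => by rw [Finset.inter_comm]; exact h⟩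
  loopless := ⟨fun S h => by
    have hS : (S : Finset ℕ).card = k := S.2
    rw [Finset.inter_self, hS] at h
    omega⟩

/-- The Johnson graph as a first-order structure in the language of graphs. -/
instance johnsonStructure (k : ℕ) : Language.graph.Structure (Set.powersetCard ℕ k) :=
  (johnsonGraph k).structure

/-- `IsFOReduct L L' A`: the `L`-structure on `A` is a first-order reduct of the `L'`-structure
on `A`, i.e. every relation of the former is first-order definable, without parameters, in the
latter. (Structures here are relational.) -/
def IsFOReduct (L : Language) (L' : Language) (A : Type*) [L.IsRelational]
    [L.Structure A] [L'.Structure A] : Prop :=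
  ∀ (m : ℕ) (R : L.Relations m),
    (∅ : Set A).Definable L' {x : Fin m → A | Structure.RelMap R x}

/-- First-order interdefinability of two relational structures on the same domain. -/
def Interdefinable (L : Language) (L' : Language) (A : Type*) [L.IsRelational] [L'.IsRelational]
    [L.Structure A] [L'.Structure A] : Prop :=
  IsFOReduct L L' A ∧ IsFOReduct L' L A

/-- Every endomorphism preserves all first-order formulas. For an `ω`-categorical structure this
is the definition of being a model-complete core. -/
def IsModelCompleteCore (L : Language) (A : Type*) [L.Structure A] : Prop :=
  ∀ (e : A →[L] A) (m : ℕ) (φ : L.Formula (Fin m)) (x : Fin m → A),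
    φ.Realize x → φ.Realize (e ∘ x)

/-- The power `Aⁿ` of a structure, with coordinatewise functions and relations. -/
instance powerStructure (L : Language) (A : Type*) [L.Structure A] (n : ℕ) :
    L.Structure (Fin n → A) where
  funMap F x := fun i => Structure.funMap F fun j => x j i
  RelMap R x := ∀ i, Structure.RelMap R fun j => x j i

/-- An `n`-ary polymorphism of `A` is a homomorphism from `Aⁿ` to `A`. -/
abbrev Polymorphism (L : Language) (A : Type*) [L.Structure A] (n : ℕ) :=
  (Fin n → A) →[L] A

/-- An operation that depends on (at most) one of its arguments. -/
def EssentiallyUnary {A : Type*} {n : ℕ} (f : (Fin n → A) → A) : Prop :=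
  ∃ (i : Fin n) (α : A → A), ∀ x, f x = α (x i)

/-- The automorphism group of a structure, as a permutation group on its domain. -/
def autGroup (L : Language) (A : Type*) [L.Structure A] : Subgroup (Equiv.Perm A) where
  carrier := {σ | ∃ e : A ≃[L] A, e.toEquiv = σ}
  one_mem' := ⟨Language.Equiv.refl L A, rfl⟩
  mul_mem' := by
    rintro _ _ ⟨e, rfl⟩ ⟨e', rfl⟩
    exact ⟨e.comp e', rfl⟩
  inv_mem' := by
    rintro _ ⟨e, rfl⟩
    exact ⟨e.symm, rfl⟩

/-- A clone on `A`: a set of finitary operations that contains all projections and is closed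
under composition. -/
@[ext]
structure Clone (A : Type*) where
  /-- The `n`-ary operations of the clone. -/
  ops : (n : ℕ) → Set ((Fin n → A) → A)
  proj_mem : ∀ (n : ℕ) (i : Fin n), (fun x => x i) ∈ ops n
  comp_mem : ∀ (n m : ℕ) (f : (Fin n → A) → A) (g : Fin n → (Fin m → A) → A),
    f ∈ ops n → (∀ i, g i ∈ ops m) → (fun x => f fun i => g i x) ∈ ops m

/-- The unary operations of a clone, as self-maps of `A`. -/
def Clone.unary {A : Type*} (C : Clone A) : Set (A → A) :=
  {h | (fun x : Fin 1 → A => h (x 0)) ∈ C.ops 1}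

/-- The smallest clone that contains a given set of unary operations. -/
def Clone.generate {A : Type*} (S : Set (A → A)) : Clone A where
  ops n := {f | ∀ C : Clone A, S ⊆ C.unary → f ∈ C.ops n}
  proj_mem n i := fun C _ => C.proj_mem n i
  comp_mem n m f g hf hg := fun C hC =>
    C.comp_mem n m f g (hf C hC) fun i => hg i C hC

/-- The closure of a permutation group in `A → A` under the topology of pointwise convergence,
that is, the product topology for the discrete topology on `A`. -/
def pointwiseClosure {A : Type*} (G : Subgroup (Equiv.Perm A)) : Set (A → A) :=
  letI : TopologicalSpace A := ⊥
  closure ((fun σ : Equiv.Perm A => (σ : A → A)) '' (G : Set (Equiv.Perm A)))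

/-- A permutation group is collapsing if the clone generated by its closure is the one and only
clone whose unary operations are exactly the elements of its closure. -/
def IsCollapsing {A : Type*} (G : Subgroup (Equiv.Perm A)) : Prop :=
  ∀ C : Clone A, C.unary = pointwiseClosure G ↔ C = Clone.generate (pointwiseClosure G)

end JohnsonCollapse

/-! Both parts reduce to one statement on an operation `f` on `k`-sets (`exists_eq_map_of_comp`): if
for all injections g_1, …, g_n of ℕ the map S ↦ f(g_1 S, …, g_n S) is induced by an injection h(g),
then `f` applies one fixed injection to one of its arguments.

The value of h(g) at a point a depends only on the tuple (g_i(a)), so `f` induces an operation on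
points. This operation separates tuples that differ in every coordinate. Swapping two points of S in
a single g_i does not change g_i S, and the resulting exchange property forces the point operation
to depend on exactly one argument.

The hypothesis on `f` holds because the relevant unary maps preserve distances in J(k), hence sizes
of intersections; such maps are induced by injections, as infinite sunflowers show
(`exists_eq_map_of_card_inter`). For a model-complete core this applies to its endomorphisms, since
distance is first-order definable; for a clone, to the closure of the automorphism group. -/

namespace JohnsonCollapse

open FirstOrder FirstOrder.Language

/-! ### Operations on `k`-sets and the induced operation on points -/

section Operations

/-- Two injective families indexed by at least two points are equal as soon as their images agree
on the complement of each point. -/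
theorem eq_of_map_erase_eq {ι : Type*} [Fintype ι] [DecidableEq ι] [Nontrivial ι] {p q : ι ↪ ℕ}
    (h : ∀ j, (Finset.univ.erase j).map p = (Finset.univ.erase j).map q) (j : ι) : p j = q j := by
  obtain ⟨j', hj'⟩ := exists_ne j
  -- The preimage of `p j` under `q` differs from every `l ≠ j`, so it is `j`.
  have mem : ∀ l, l ≠ j → ∃ m, m ≠ l ∧ q m = p j := by
    intro l hl
    have : p j ∈ (Finset.univ.erase l).map q := by
      rw [← h l]
      exact Finset.mem_map_of_mem p (Finset.mem_erase.2 ⟨hl.symm, Finset.mem_univ j⟩)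
    obtain ⟨m, hm, hpm⟩ := Finset.mem_map.1 this
    exact ⟨m, (Finset.mem_erase.1 hm).1, hpm⟩
  obtain ⟨l, -, hl⟩ := mem j' hj'
  by_cases hlj : l = j
  · rw [← hl, hlj]
  · obtain ⟨m, hml, hm⟩ := mem l hlj
    exact absurd (q.injective (hm.trans hl.symm)) hml

variable {k n : ℕ} {f : (Fin n → Set.powersetCard ℕ k) → Set.powersetCard ℕ k}
  {h : (Fin n → ℕ ↪ ℕ) → ℕ ↪ ℕ}

/-- The induced injections agree at `k + 1` common points of two families of injections. -/
theorem induced_eq_of_agree (hk : 1 ≤ k)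
    (hf : ∀ g S, f (fun i => Set.powersetCard.map k (g i) S) = Set.powersetCard.map k (h g) S)
    {g g' : Fin n → ℕ ↪ ℕ} {P P' : Fin (k + 1) → ℕ} (iP : Function.Injective P)
    (iP' : Function.Injective P') (hP : ∀ i j, g i (P j) = g' i (P' j))
    (j : Fin (k + 1)) : h g (P j) = h g' (P' j) := by
  lift P to Fin (k + 1) ↪ ℕ using iP
  lift P' to Fin (k + 1) ↪ ℕ using iP'
  have : Nontrivial (Fin (k + 1)) := Fin.nontrivial_iff_two_le.2 (by omega)
  refine eq_of_map_erase_eq (p := P.trans (h g)) (q := P'.trans (h g')) (fun l => ?_) j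
  have hc : ∀ Q : Fin (k + 1) ↪ ℕ, ((Finset.univ.erase l).map Q).card = k := by simp
  have key := hf g ⟨_, hc P⟩
  have hPP : (fun i => Set.powersetCard.map k (g i) ⟨_, hc P⟩) =
      fun i => Set.powersetCard.map k (g' i) ⟨_, hc P'⟩ := by
    funext i
    apply Subtype.ext
    simp only [Set.powersetCard.val_map, Finset.map_map]
    congr 1
    ext j
    exact hP i j
  rw [hPP, hf g'] at key
  have := congrArg Subtype.val key
  simp only [Set.powersetCard.val_map, Finset.map_map] at this
  exact this.symm

/-- The operation on points that is induced by an operation on `k`-sets. -/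
def pointOperation (h : (Fin n → ℕ ↪ ℕ) → ℕ ↪ ℕ) (u : Fin n → ℕ) : ℕ :=
  h (fun i => addLeftEmbedding (u i)) 0

/-- Interpolation: `g'` shares `k + 1` points with `g`, among them `a`, and `k + 1` points with the
translations by `g i a` that define `pointOperation`. Each time the common points determine the
value of `h`. -/
theorem induced_apply (hk : 1 ≤ k)
    (hf : ∀ g S, f (fun i => Set.powersetCard.map k (g i) S) = Set.powersetCard.map k (h g) S)
    (g : Fin n → ℕ ↪ ℕ) (a : ℕ) : h g a = pointOperation h fun i => g i a := by
  obtain ⟨N, hN⟩ : ∃ N, ∀ i, ∀ j ≤ k, g i (a + j) < N := by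
    refine ⟨∑ i, ∑ j ∈ Finset.range (k + 1), g i (a + j) + 1, fun i j hj => Nat.lt_succ_of_le ?_⟩
    calc g i (a + j) ≤ ∑ j ∈ Finset.range (k + 1), g i (a + j) :=
          Finset.single_le_sum (f := fun j => g i (a + j)) (fun _ _ => Nat.zero_le _)
            (Finset.mem_range.2 (by omega))
      _ ≤ _ := Finset.single_le_sum
          (f := fun i => ∑ j ∈ Finset.range (k + 1), g i (a + j)) (fun _ _ => Nat.zero_le _)
            (Finset.mem_univ i)
  -- The bound `N` makes the two branches disjoint. It is uniform in `i`, so that the matching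
  -- points of the translations, 0 and `N + k + j`, are the same for all `i`.
  let g' : Fin n → ℕ ↪ ℕ := fun i =>
    ⟨fun j => if j ≤ k then g i (a + j) else g i a + (N + j), by
      intro x y hxy
      dsimp only at hxy
      split_ifs at hxy with hx hy hy
      · exact Nat.add_left_cancel ((g i).injective hxy)
      · have := hN i x hx
        omega
      · have := hN i y hy
        omega
      · omega⟩
  have hg' : ∀ i j, g' i j = if j ≤ k then g i (a + j) else g i a + (N + j) := fun _ _ => rfl
  have h1 : h g a = h g' 0 := by
    have := induced_eq_of_agree hk hf (g := g) (g' := g')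
      (P := fun j => a + j) (P' := fun j => j)
      (fun x y hxy => Fin.ext (Nat.add_left_cancel hxy)) Fin.val_injective
      (fun i j => by
        have := j.is_lt
        simp [hg', Nat.lt_succ_iff.1 this]) 0
    simpa using this
  have h2 : h g' 0 = pointOperation h fun i => g i a := by
    have := induced_eq_of_agree hk hf (g := g') (g' := fun i => addLeftEmbedding (g i a))
      (P := fun j => if (j : ℕ) = 0 then 0 else k + j)
      (P' := fun j => if (j : ℕ) = 0 then 0 else N + k + j)
      (fun x y hxy => by
        dsimp only at hxy
        apply Fin.ext
        split_ifs at hxy <;> omega)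
      (fun x y hxy => by
        dsimp only at hxy
        apply Fin.ext
        split_ifs at hxy <;> omega)
      (fun i j => by
        split_ifs with hj
        · simp [hg']
        · rw [hg', if_neg (by omega), addLeftEmbedding_apply]
          omega) 0
    simpa [pointOperation] using this
  rw [h1, h2]

/-- An injection of `ℕ` with two prescribed values. -/
theorem exists_embedding_pair {a b : ℕ} (hab : a ≠ b) : ∃ g : ℕ ↪ ℕ, g 0 = a ∧ g 1 = b := by
  refine ⟨⟨fun j => if j = 0 then a else if j = 1 then b else a + b + j, fun x y hxy => ?_⟩, ?_, ?_⟩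
  · dsimp only at hxy
    split_ifs at hxy <;> omega
  · rfl
  · rfl

theorem pointOperation_ne (hk : 1 ≤ k)
    (hf : ∀ g S, f (fun i => Set.powersetCard.map k (g i) S) = Set.powersetCard.map k (h g) S)
    {u v : Fin n → ℕ} (huv : ∀ i, u i ≠ v i) : pointOperation h u ≠ pointOperation h v := by
  choose g hg0 hg1 using fun i => exists_embedding_pair (huv i)
  have h0 := induced_apply hk hf g 0
  have h1 := induced_apply hk hf g 1
  simp only [hg0, hg1] at h0 h1
  rw [← h0, ← h1]
  exact (h g).injective.ne zero_ne_one

/-- Let `g` send 0 to `u` and 1 to `v`, and precompose only `g i` with the swap of 0 and 1. As `k ≥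
2`, the set {0, …, k - 1} is invariant under the swap, so its images under `h g` and `h g'`
coincide. Hence `h g 0` is a value of `h g'`, taken at 0 or 1 because both maps agree at all other
points. -/
theorem pointOperation_exchange (hk : 2 ≤ k)
    (hf : ∀ g S, f (fun i => Set.powersetCard.map k (g i) S) = Set.powersetCard.map k (h g) S)
    {u v : Fin n → ℕ} (huv : ∀ i, u i ≠ v i) (i : Fin n) :
    pointOperation h u = pointOperation h (Function.update u i (v i)) ∨
      pointOperation h u = pointOperation h (Function.update v i (u i)) := by
  have hk1 : 1 ≤ k := by omega
  choose g hg0 hg1 using fun i => exists_embedding_pair (huv i)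
  let g' : Fin n → ℕ ↪ ℕ :=
    Function.update g i ((Equiv.swap 0 1).toEmbedding.trans (g i))
  let S : Set.powersetCard ℕ k := ⟨Finset.range k, Finset.card_range k⟩
  have hS : (Finset.range k).map (Equiv.swap 0 1).toEmbedding = Finset.range k := by
    ext x
    simp only [Finset.mem_map_equiv, Equiv.symm_swap, Finset.mem_range]
    rcases eq_or_ne x 0 with rfl | h0
    · simp; omega
    rcases eq_or_ne x 1 with rfl | h1
    · simp; omega
    rw [Equiv.swap_apply_of_ne_of_ne h0 h1]
  have hgg : (fun l => Set.powersetCard.map k (g l) S) =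
      fun l => Set.powersetCard.map k (g' l) S := by
    funext l
    apply Subtype.ext
    rcases eq_or_ne l i with rfl | hl
    · simp only [g', Function.update_self, Set.powersetCard.val_map, S]
      rw [← Finset.map_map, hS]
    · simp only [g', Function.update_of_ne hl]
  have key := hf g S
  rw [hgg, hf g'] at key
  have key := congrArg Subtype.val key
  simp only [Set.powersetCard.val_map, S] at key
  have hmem : h g 0 ∈ (Finset.range k).map (h g') := by
    rw [key]
    exact Finset.mem_map_of_mem _ (Finset.mem_range.2 (by omega))
  obtain ⟨j, -, hj⟩ := Finset.mem_map.1 hmem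
  have e0 : h g 0 = pointOperation h u := by simp [induced_apply hk1 hf, hg0]
  have hg' : ∀ x, (fun l => g' l x) = Function.update (fun l => g l x) i (g i (Equiv.swap 0 1 x)) := by
    intro x
    funext l
    rcases eq_or_ne l i with rfl | hl
    · simp [g']
    · simp [g', Function.update_of_ne hl]
  rcases eq_or_ne j 0 with rfl | h0
  · left
    rw [← e0, ← hj, induced_apply hk1 hf, hg']
    simp [hg0, hg1]
  rcases eq_or_ne j 1 with rfl | h1
  · right
    rw [← e0, ← hj, induced_apply hk1 hf, hg']
    simp [hg0, hg1]
  · exfalso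
    rw [induced_apply hk1 hf, hg', Equiv.swap_apply_of_ne_of_ne h0 h1, Function.update_eq_self,
      ← induced_apply hk1 hf] at hj
    exact h0 ((h g).injective hj)

theorem pointOperation_exchange_symm (hk : 2 ≤ k)
    (hf : ∀ g S, f (fun i => Set.powersetCard.map k (g i) S) = Set.powersetCard.map k (h g) S)
    {u v : Fin n → ℕ} (huv : ∀ i, u i ≠ v i) {i : Fin n}
    (hu : pointOperation h u = pointOperation h (Function.update u i (v i))) :
    pointOperation h v = pointOperation h (Function.update v i (u i)) := by
  rcases pointOperation_exchange hk hf (fun l => (huv l).symm) i with hv | hv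
  · exact hv
  · exact absurd (hu.trans hv.symm) (pointOperation_ne (by omega) hf huv)

theorem exists_avoiding (u v : Fin n → ℕ) : ∃ w : Fin n → ℕ, ∀ i, w i ≠ u i ∧ w i ≠ v i :=
  ⟨fun i => u i + v i + 1, fun i => by constructor <;> dsimp only <;> omega⟩

/-- If the induced point operation ignores one change of its `i`-th argument, then it does not
depend on its `i`-th argument. -/
theorem pointOperation_update (hk : 2 ≤ k)
    (hf : ∀ g S, f (fun i => Set.powersetCard.map k (g i) S) = Set.powersetCard.map k (h g) S)
    {u : Fin n → ℕ} {i : Fin n} {b : ℕ} (hb : b ≠ u i)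
    (hu : pointOperation h u = pointOperation h (Function.update u i b)) (w : Fin n → ℕ) (c : ℕ) :
    pointOperation h w = pointOperation h (Function.update w i c) := by
  have hk1 : 1 ≤ k := by omega
  -- If `w` avoids `u` off `i`, the ignored change carries over from `u` to `w` by the symmetric
  -- exchange; an arbitrary `w` is then reached through a tuple avoiding both.
  have step : ∀ u w : Fin n → ℕ, (∀ l, l ≠ i → u l ≠ w l) → b ≠ u i →
      pointOperation h u = pointOperation h (Function.update u i b) →
      pointOperation h (Function.update w i (u i)) = pointOperation h (Function.update w i b) := by
    intro u w huw hb hu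
    have := pointOperation_exchange_symm hk hf (u := u) (v := Function.update w i b) (i := i)
      (fun l => by
        rcases eq_or_ne l i with rfl | hl
        · simpa using hb.symm
        · simpa [Function.update_of_ne hl] using huw l hl) (by simpa using hu)
    simpa using this.symm
  have all : ∀ w : Fin n → ℕ,
      pointOperation h (Function.update w i (u i)) = pointOperation h (Function.update w i b) := by
    intro w
    obtain ⟨x, hx⟩ := exists_avoiding u w
    have h1 := step u x (fun l _ => (hx l).1.symm) hb hu
    have h2 := step (Function.update x i (u i)) w
      (fun l hl => by simpa [Function.update_of_ne hl] using (hx l).2) (by simpa using hb)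
      (by simpa using h1)
    simpa using h2
  have main : ∀ (w : Fin n → ℕ) (c : ℕ),
      pointOperation h (Function.update w i (u i)) = pointOperation h (Function.update w i c) := by
    intro w c
    rcases eq_or_ne c (u i) with rfl | hc
    · rfl
    obtain ⟨x, hx⟩ := exists_avoiding w w
    have hne : ∀ c d, c ≠ d → ∀ l, Function.update w i c l ≠ Function.update x i d l := by
      intro c d hcd l
      rcases eq_or_ne l i with rfl | hl
      · simpa using hcd
      · simpa [Function.update_of_ne hl] using (hx l).1.symm
    rcases pointOperation_exchange hk hf (hne (u i) c hc.symm) i with h1 | h1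
    · simpa using h1
    · exfalso
      -- The other alternative of the exchange would identify the values at `w` with entry `b` and
      -- at `x` with entry `u i`, two tuples that differ everywhere.
      refine pointOperation_ne hk1 hf (hne b (u i) hb) ?_
      rw [← all w, h1]
      simp
  have hw := main w (w i)
  rw [Function.update_eq_self] at hw
  rw [← hw, main w c]

/-- The induced point operation depends on one argument only. -/
theorem exists_pointOperation_eq (hk : 2 ≤ k)
    (hf : ∀ g S, f (fun i => Set.powersetCard.map k (g i) S) = Set.powersetCard.map k (h g) S) :
    ∃ i, ∀ u, pointOperation h u = pointOperation h fun _ => u i := by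
  have hk1 : 1 ≤ k := by omega
  by_cases hdep : ∃ i, ∀ (u : Fin n → ℕ) (b : ℕ), b ≠ u i →
      pointOperation h u ≠ pointOperation h (Function.update u i b)
  · obtain ⟨i, hi⟩ := hdep
    have step : ∀ u v : Fin n → ℕ, (∀ l, u l ≠ v l) →
        pointOperation h u = pointOperation h (Function.update v i (u i)) := fun u v huv =>
      (pointOperation_exchange hk hf huv i).resolve_left (hi u _ (huv i).symm)
    refine ⟨i, fun u => ?_⟩
    -- Both `u` and the constant tuple `u i` have the value of `v` with `i`-th entry `u i`.
    obtain ⟨v, hv⟩ := exists_avoiding u fun _ => u i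
    rw [step u v fun l => (hv l).1.symm, step (fun _ => u i) v fun l => (hv l).2.symm]
  · exfalso
    push Not at hdep
    have hupd : ∀ i w c, pointOperation h w = pointOperation h (Function.update w i c) := by
      intro i w c
      obtain ⟨u, b, hb, hu⟩ := hdep i
      exact pointOperation_update hk hf hb hu w c
    have hpiece : ∀ (u v : Fin n → ℕ) (s : Finset (Fin n)),
        pointOperation h (s.piecewise v u) = pointOperation h u := by
      intro u v s
      induction s using Finset.induction_on with
      | empty => simp
      | insert i s _ ih => rw [Finset.piecewise_insert, ← hupd, ih]
    -- This also excludes `n = 0`, where the two tuples coincide but vacuously differ everywhere.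
    refine pointOperation_ne hk1 hf (u := fun _ => 1) (v := fun _ => 0) (fun _ => one_ne_zero) ?_
    simpa using hpiece (fun _ => 0) (fun _ => 1) Finset.univ

/-- Every `k`-set is the image of the first `k` natural numbers under an injection. -/
theorem exists_map_range_eq (S : Set.powersetCard ℕ k) :
    ∃ p : ℕ ↪ ℕ, Set.powersetCard.map k p ⟨Finset.range k, Finset.card_range k⟩ = S := by
  have := Equiv.Perm.isMultiplyPretransitive ℕ k
  obtain ⟨y, rfl⟩ := Set.powersetCard.ofFinEmb_surjective k ℕ S
  obtain ⟨σ, hσ⟩ := MulAction.exists_smul_eq (Equiv.Perm ℕ) (Fin.valEmbedding (n := k)) y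
  refine ⟨σ.toEmbedding, Subtype.ext ?_⟩
  rw [Set.powersetCard.val_map, Set.powersetCard.val_ofFinEmb, ← hσ]
  ext x
  suffices σ.symm x < k ↔ ∃ i < k, σ i = x by simpa [Fin.exists_iff]
  refine ⟨fun h => ⟨_, h, by simp⟩, ?_⟩
  rintro ⟨i, hi, rfl⟩
  simpa using hi

/-- If all compositions of an operation on `k`-sets with maps that come from injections come from
injections, then the operation itself comes from an injection that is applied to one argument. -/
theorem exists_eq_map_of_comp (hk : 2 ≤ k)
    (hf : ∀ g : Fin n → ℕ ↪ ℕ, ∃ h : ℕ ↪ ℕ, ∀ S,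
      f (fun i => Set.powersetCard.map k (g i) S) = Set.powersetCard.map k h S) :
    ∃ (i : Fin n) (h : ℕ ↪ ℕ), ∀ x, f x = Set.powersetCard.map k h (x i) := by
  choose h hf using hf
  have hk1 : 1 ≤ k := by omega
  obtain ⟨i, hi⟩ := exists_pointOperation_eq hk hf
  refine ⟨i, ⟨fun a => pointOperation h fun _ => a, fun a b hab => ?_⟩, fun x => ?_⟩
  · by_contra hne
    exact pointOperation_ne hk1 hf (fun _ => hne) hab
  · choose p hp using fun i => exists_map_range_eq (x i)
    have := hf p ⟨Finset.range k, Finset.card_range k⟩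
    simp only [hp] at this
    rw [this, ← hp i]
    apply Subtype.ext
    simp only [Set.powersetCard.val_map, Finset.map_map]
    congr 1
    ext a
    rw [induced_apply hk1 hf, hi]
    rfl

end Operations

/-! ### Maps that preserve sizes of intersections -/

section Intersections

variable {k : ℕ}

/-- The `i`-th petal, together with `a`, of a sunflower of `k`-sets with core `{a}`. -/
def petal (m a i : ℕ) : Set.powersetCard ℕ (m + 1) :=
  ⟨insert a (Finset.Ico (a + 1 + i * m) (a + 1 + (i + 1) * m)), by
    rw [Set.powersetCard.mem_iff, Finset.card_insert_of_notMem, Nat.card_Ico, Nat.add_mul]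
    · omega
    · rw [Finset.mem_Ico]
      omega⟩

theorem mem_petal {m a i x : ℕ} :
    x ∈ (petal m a i : Finset ℕ) ↔ x = a ∨ a + 1 + i * m ≤ x ∧ x < a + 1 + (i + 1) * m := by
  simp [petal]

theorem petal_inter {m a i j : ℕ} (hij : i ≠ j) :
    (petal m a i : Finset ℕ) ∩ (petal m a j : Finset ℕ) = {a} := by
  wlog h : i < j generalizing i j
  · rw [Finset.inter_comm]
    exact this hij.symm (by omega)
  have := Nat.mul_le_mul_right m (show i + 1 ≤ j from h)
  ext x
  rw [Finset.mem_inter, mem_petal, mem_petal, Finset.mem_singleton]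
  omega

/-- All but finitely many petals meet a given finite set at most in the core. -/
theorem exists_petal_inter_subset {m a : ℕ} (S : Finset ℕ) {I : Set ℕ} (hI : I.Infinite) :
    ∃ i ∈ I, (S ∩ (petal m a i : Finset ℕ)) ⊆ {a} := by
  rcases Nat.eq_zero_or_pos m with rfl | hm
  · obtain ⟨i, hi⟩ := hI.nonempty
    refine ⟨i, hi, fun x hx => ?_⟩
    rw [Finset.mem_inter, mem_petal] at hx
    rw [Finset.mem_singleton]
    omega
  obtain ⟨i, hi, hlt⟩ := hI.exists_gt (S.sup id)
  refine ⟨i, hi, fun x hx => ?_⟩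
  rw [Finset.mem_inter, mem_petal] at hx
  have h1 : x ≤ S.sup id := Finset.le_sup (f := id) hx.1
  have h2 := Nat.le_mul_of_pos_right i hm
  rw [Finset.mem_singleton]
  omega

/-- A finite set that meets infinitely many sets has a point in infinitely many of them. -/
theorem exists_mem_infinite {T : Finset ℕ} {F : ℕ → Finset ℕ} {I : Set ℕ} (hI : I.Infinite)
    (h : ∀ i ∈ I, (T ∩ F i).Nonempty) : ∃ c ∈ T, {i ∈ I | c ∈ F i}.Infinite := by
  by_contra hc
  push Not at hc
  refine hI ((Set.Finite.biUnion T.finite_toSet fun c hcT => hc c hcT).subset fun i hi => ?_)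
  obtain ⟨c, hcm⟩ := h i hi
  rw [Finset.mem_inter] at hcm
  exact Set.mem_biUnion (Finset.mem_coe.2 hcm.1) ⟨hi, hcm.2⟩

/-- A self-map of the `k`-subsets of `ℕ` that preserves the sizes of intersections is induced by
an injection. -/
theorem exists_eq_map_of_card_inter (hk : 1 ≤ k)
    {f : Set.powersetCard ℕ k → Set.powersetCard ℕ k}
    (hf : ∀ S T, ((f S : Finset ℕ) ∩ (f T : Finset ℕ)).card = ((S : Finset ℕ) ∩ (T : Finset ℕ)).card) :
    ∃ h : ℕ ↪ ℕ, ∀ S, f S = Set.powersetCard.map k h S := by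
  obtain ⟨m, rfl⟩ : ∃ m, k = m + 1 := ⟨k - 1, by omega⟩
  have hne : ∀ S T, ((f S : Finset ℕ) ∩ (f T : Finset ℕ)).Nonempty ↔
      ((S : Finset ℕ) ∩ (T : Finset ℕ)).Nonempty := by
    intro S T
    rw [← Finset.card_pos, hf, Finset.card_pos]
  -- The image of petal 0 is finite and meets the images of all petals at `a`; by pigeonhole one
  -- point `c a` lies in infinitely many of them. It is the image of the core.
  have core : ∀ a, ∃ c, {i | c ∈ (f (petal m a i) : Finset ℕ)}.Infinite := by
    intro a
    obtain ⟨c, -, hc⟩ := exists_mem_infinite (T := f (petal m a 0))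
      (F := fun i => f (petal m a i)) (Set.infinite_univ) (fun i _ => by
        rw [hne]
        exact ⟨a, Finset.mem_inter.2 ⟨mem_petal.2 (Or.inl rfl), mem_petal.2 (Or.inl rfl)⟩⟩)
    exact ⟨c, hc.mono fun i hi => hi.2⟩
  choose c hc using core
  have mem : ∀ S a, c a ∈ (f S : Finset ℕ) ↔ a ∈ (S : Finset ℕ) := by
    intro S a
    constructor
    · intro h
      obtain ⟨i, hi, hsub⟩ := exists_petal_inter_subset (m := m) (a := a) S (hc a)
      obtain ⟨x, hx⟩ := (hne S (petal m a i)).1 ⟨c a, Finset.mem_inter.2 ⟨h, hi⟩⟩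
      have := Finset.mem_singleton.1 (hsub hx)
      rw [← this]
      exact (Finset.mem_inter.1 hx).1
    · intro h
      obtain ⟨d, hdS, hd⟩ := exists_mem_infinite (T := f S)
        (F := fun i => f (petal m a i)) (hc a) (fun i _ => by
          rw [hne]
          exact ⟨a, Finset.mem_inter.2 ⟨h, mem_petal.2 (Or.inl rfl)⟩⟩)
      -- Two distinct petals meet in one point, hence so do their images; both `d` and `c a` lie
      -- there.
      obtain ⟨i, hi, j, hj, hij⟩ := hd.nontrivial
      have hcard := hf (petal m a i) (petal m a j)
      rw [petal_inter hij, Finset.card_singleton] at hcard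
      have := Finset.card_le_one.1 hcard.le d (Finset.mem_inter.2 ⟨hi.2, hj.2⟩) (c a)
        (Finset.mem_inter.2 ⟨hi.1, hj.1⟩)
      rwa [← this]
  have hinj : Function.Injective c := by
    intro a b hab
    by_contra hne
    obtain ⟨S, haS, hbS⟩ := Set.powersetCard.exists_mem_notMem (n := m + 1) hk
      (by simp) hne
    have h1 := (mem S a).2 haS
    rw [hab, mem] at h1
    exact hbS h1
  refine ⟨⟨c, hinj⟩, fun S => Eq.symm (Set.powersetCard.eq_iff_subset.2 fun x hx => ?_)⟩
  rw [Set.powersetCard.val_map, Finset.mem_map] at hx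
  obtain ⟨a, ha, rfl⟩ := hx
  exact (mem S a).2 ha

/-- On a finite set, an injection agrees with a permutation. -/
theorem exists_perm_eqOn {α : Type*} [Infinite α] (h : α ↪ α) (s : Finset α) :
    ∃ σ : Equiv.Perm α, ∀ a ∈ s, σ a = h a := by
  have := Equiv.Perm.isMultiplyPretransitive α s.card
  let x : Fin s.card ↪ α := s.equivFin.symm.toEmbedding.trans (Function.Embedding.subtype _)
  obtain ⟨σ, hσ⟩ := MulAction.exists_smul_eq (Equiv.Perm α) x (x.trans h)
  refine ⟨σ, fun a ha => ?_⟩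
  have := DFunLike.congr_fun hσ (s.equivFin ⟨a, ha⟩)
  simpa [x] using this

/-- On finitely many `k`-sets, an injection acts as a permutation. -/
theorem exists_perm_map_eqOn (h : ℕ ↪ ℕ) {F : Set (Set.powersetCard ℕ k)} (hF : F.Finite) :
    ∃ σ : Equiv.Perm ℕ, ∀ S ∈ F,
      Set.powersetCard.map k σ.toEmbedding S = Set.powersetCard.map k h S := by
  obtain ⟨σ, hσ⟩ := exists_perm_eqOn h (hF.toFinset.biUnion fun S => (S : Finset ℕ))
  refine ⟨σ, fun S hS => Subtype.ext ?_⟩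
  simp only [Set.powersetCard.val_map, Finset.map_eq_image]
  exact Finset.image_congr fun a ha =>
    hσ a (Finset.mem_biUnion.2 ⟨S, hF.mem_toFinset.2 hS, ha⟩)

end Intersections

/-! ### Distance in the Johnson graph -/

section Distance

variable {k : ℕ}

/-- Two `k`-sets are at distance at most `j` in the Johnson graph. -/
def Near (j : ℕ) (S T : Set.powersetCard ℕ k) : Prop :=
  k ≤ ((S : Finset ℕ) ∩ (T : Finset ℕ)).card + j

theorem near_zero {S T : Set.powersetCard ℕ k} : Near 0 S T ↔ S = T := by
  rw [Set.powersetCard.eq_iff_subset, ← Finset.inter_eq_left, Near, add_zero]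
  refine ⟨fun h => Finset.eq_of_subset_of_card_le Finset.inter_subset_left (by simpa using h),
    fun h => by simp [h]⟩

theorem near_one {S T : Set.powersetCard ℕ k} :
    Near 1 S T ↔ S = T ∨ (johnsonGraph k).Adj S T := by
  rw [← near_zero]
  have := Finset.card_le_card (Finset.inter_subset_left (s₁ := (S : Finset ℕ)) (s₂ := T))
  rw [Set.powersetCard.card_eq] at this
  simp only [Near, johnsonGraph]
  omega

/-- Exchanging a point of S outside T for a point of T outside S is a step towards T; conversely,
inclusion-exclusion inside U gives the triangle inequality. This recursion makes distance both
invariant under automorphisms and first-order definable. -/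
theorem near_succ {j : ℕ} {S T : Set.powersetCard ℕ k} :
    Near (j + 1) S T ↔ ∃ U, Near 1 S U ∧ Near j U T := by
  constructor
  · intro h
    by_cases hj : Near j S T
    · exact ⟨S, near_one.2 (Or.inl rfl), hj⟩
    rw [Near] at h hj
    have hcard : ((S : Finset ℕ) ∩ T).card < (S : Finset ℕ).card := by
      rw [Set.powersetCard.card_eq]; omega
    have hcard' : ((S : Finset ℕ) ∩ T).card < (T : Finset ℕ).card := by
      rw [Set.powersetCard.card_eq]; omega
    obtain ⟨a, haS, ha⟩ := Finset.exists_mem_notMem_of_card_lt_card hcard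
    obtain ⟨b, hbT, hb⟩ := Finset.exists_mem_notMem_of_card_lt_card hcard'
    have haT : a ∉ (T : Finset ℕ) := fun h => ha (Finset.mem_inter.2 ⟨haS, h⟩)
    have hbS : b ∉ (S : Finset ℕ) := fun h => hb (Finset.mem_inter.2 ⟨h, hbT⟩)
    have hU : (insert b ((S : Finset ℕ).erase a)).card = k := by
      rw [Finset.card_insert_of_notMem (fun h => hbS (Finset.mem_of_mem_erase h)),
        Finset.card_erase_add_one haS, Set.powersetCard.card_eq]
    refine ⟨⟨_, hU⟩, ?_, ?_⟩
    · have : (S : Finset ℕ).erase a ⊆ (S : Finset ℕ) ∩ insert b ((S : Finset ℕ).erase a) :=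
        Finset.subset_inter (Finset.erase_subset _ _) (Finset.subset_insert _ _)
      have := Finset.card_le_card this
      rw [Finset.card_erase_of_mem haS, Set.powersetCard.card_eq] at this
      rw [Near]
      dsimp only
      omega
    · have : insert b ((S : Finset ℕ) ∩ T) ⊆ insert b ((S : Finset ℕ).erase a) ∩ T := by
        intro x hx
        simp only [Finset.mem_insert, Finset.mem_inter, Finset.mem_erase] at hx ⊢
        rcases hx with rfl | ⟨hxS, hxT⟩
        · exact ⟨Or.inl rfl, hbT⟩
        · exact ⟨Or.inr ⟨fun h => haT (h ▸ hxT), hxS⟩, hxT⟩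
      have := Finset.card_le_card this
      rw [Finset.card_insert_of_notMem hb] at this
      rw [Near]
      dsimp only
      omega
  · rintro ⟨U, h1, h2⟩
    rw [Near] at *
    have hsub : ((S : Finset ℕ) ∩ U) ∩ ((U : Finset ℕ) ∩ T) ⊆ (S : Finset ℕ) ∩ T := by
      intro x hx
      simp only [Finset.mem_inter] at hx ⊢
      exact ⟨hx.1.1, hx.2.2⟩
    have hunion : ((S : Finset ℕ) ∩ U) ∪ ((U : Finset ℕ) ∩ T) ⊆ (U : Finset ℕ) :=
      Finset.union_subset Finset.inter_subset_right Finset.inter_subset_left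
    have c1 := Finset.card_le_card hsub
    have c2 := Finset.card_le_card hunion
    have c3 := Finset.card_union_add_card_inter ((S : Finset ℕ) ∩ U) ((U : Finset ℕ) ∩ T)
    rw [Set.powersetCard.card_eq] at c2
    omega

/-- A self-map of the `k`-subsets of `ℕ` that preserves distances in the Johnson graph is induced
by an injection. -/
theorem exists_eq_map_of_near (hk : 1 ≤ k) {f : Set.powersetCard ℕ k → Set.powersetCard ℕ k}
    (hf : ∀ j S T, Near j (f S) (f T) ↔ Near j S T) :
    ∃ h : ℕ ↪ ℕ, ∀ S, f S = Set.powersetCard.map k h S := by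
  refine exists_eq_map_of_card_inter hk fun S T => ?_
  have le : ∀ S T : Set.powersetCard ℕ k, ((S : Finset ℕ) ∩ (T : Finset ℕ)).card ≤ k := by
    intro S T
    simpa using Finset.card_le_card (Finset.inter_subset_left (s₁ := (S : Finset ℕ)) (s₂ := T))
  have h1 := hf (k - ((S : Finset ℕ) ∩ T).card) S T
  have h2 := hf (k - ((f S : Finset ℕ) ∩ f T).card) S T
  have l1 := le S T
  have l2 := le (f S) (f T)
  rw [Near, Near] at h1 h2
  omega

end Distance

/-! ### The closure of the automorphism group -/

section Closure

theorem mem_pointwiseClosure {A : Type*} {G : Subgroup (Equiv.Perm A)} {f : A → A} :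
    f ∈ pointwiseClosure G ↔ ∀ F : Set A, F.Finite → ∃ σ ∈ G, ∀ a ∈ F, σ a = f a := by
  let _ : TopologicalSpace A := ⊥
  have : DiscreteTopology A := ⟨rfl⟩
  change f ∈ closure _ ↔ _
  rw [mem_closure_iff]
  constructor
  · intro h F hF
    obtain ⟨_, hg, σ, hσ, rfl⟩ := h (F.pi fun a => {f a})
      (isOpen_set_pi hF fun _ _ => isOpen_discrete _) fun _ _ => rfl
    exact ⟨σ, hσ, fun a ha => hg a ha⟩
  · intro h o ho hfo
    obtain ⟨I, u, hu, hIo⟩ := isOpen_pi_iff.1 ho f hfo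
    obtain ⟨σ, hσ, hσf⟩ := h I I.finite_toSet
    refine ⟨σ, hIo fun a ha => ?_, σ, hσ, rfl⟩
    dsimp only
    rw [hσf a ha]
    exact (hu a ha).2

/-- The automorphism of the Johnson graph that is induced by a permutation of `ℕ`. -/
def permAut (k : ℕ) (σ : Equiv.Perm ℕ) :
    Set.powersetCard ℕ k ≃[Language.graph] Set.powersetCard ℕ k where
  toFun := Set.powersetCard.map k σ.toEmbedding
  invFun := Set.powersetCard.map k σ.symm.toEmbedding
  left_inv S := Subtype.ext (by ext; simp)
  right_inv S := Subtype.ext (by ext; simp)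
  map_fun' F := isEmptyElim F
  map_rel' {m} R x := by
    cases R
    change ((Finset.map _ _ ∩ Finset.map _ _).card + 1 = k) ↔ ((_ ∩ _ : Finset ℕ).card + 1 = k)
    rw [← Finset.map_inter, Finset.card_map]

variable {k : ℕ}

theorem near_equiv (e : Set.powersetCard ℕ k ≃[Language.graph] Set.powersetCard ℕ k) (j : ℕ)
    (S T : Set.powersetCard ℕ k) : Near j (e S) (e T) ↔ Near j S T := by
  have h1 : ∀ S T, Near 1 (e S) (e T) ↔ Near 1 S T := by
    intro S T
    have : (johnsonGraph k).Adj (e S) (e T) ↔ (johnsonGraph k).Adj S T := by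
      have := e.map_rel adj ![S, T]
      simpa only [Structure.RelMap, Function.comp_apply, Matrix.cons_val_zero,
        Matrix.cons_val_one] using this
    rw [near_one, near_one, this, e.injective.eq_iff]
  induction j generalizing S T with
  | zero => rw [near_zero, near_zero, e.injective.eq_iff]
  | succ j ih =>
    rw [near_succ, near_succ, ← e.toEquiv.exists_congr_right]
    exact exists_congr fun U => and_congr (h1 S U) (ih U T)

/-- The closure of the automorphism group of the Johnson graph consists of the maps that are
induced by injections. -/
theorem mem_pointwiseClosure_autGroup (hk : 1 ≤ k)
    {f : Set.powersetCard ℕ k → Set.powersetCard ℕ k} :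
    f ∈ pointwiseClosure (autGroup Language.graph (Set.powersetCard ℕ k)) ↔
      ∃ h : ℕ ↪ ℕ, f = Set.powersetCard.map k h := by
  rw [mem_pointwiseClosure]
  constructor
  · intro hf
    obtain ⟨h, hh⟩ := exists_eq_map_of_near hk (f := f) fun j S T => by
      -- Distance involves only two vertices, so agreement with an automorphism on pairs suffices.
      obtain ⟨_, ⟨e, rfl⟩, he⟩ := hf {S, T} (Set.toFinite _)
      rw [← he S (by simp), ← he T (by simp)]
      exact near_equiv e j S T
    exact ⟨h, funext hh⟩
  · rintro ⟨h, rfl⟩ F hF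
    obtain ⟨σ, hσ⟩ := exists_perm_map_eqOn h hF
    exact ⟨_, ⟨permAut k σ, rfl⟩, hσ⟩

end Closure

/-! ### Definable relations and model-complete cores -/

section Definability

variable {k m : ℕ}

/-- On the finitely many entries of a tuple an injection acts like a permutation of ℕ, hence like an
automorphism. -/
theorem map_mem_of_definable {X : Set (Fin m → Set.powersetCard ℕ k)}
    (hX : (∅ : Set (Set.powersetCard ℕ k)).Definable Language.graph X) (h : ℕ ↪ ℕ)
    {x : Fin m → Set.powersetCard ℕ k} (hx : x ∈ X) :
    (fun j => Set.powersetCard.map k h (x j)) ∈ X := by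
  obtain ⟨φ, rfl⟩ := Set.empty_definable_iff.1 hX
  obtain ⟨σ, hσ⟩ := exists_perm_map_eqOn h (Set.finite_range x)
  have : (fun j => Set.powersetCard.map k h (x j)) = permAut k σ ∘ x :=
    funext fun j => (hσ _ ⟨j, rfl⟩).symm
  rw [this]
  exact (StrongHomClass.realize_formula (permAut k σ) φ).2 hx

theorem definable_near {L : FirstOrder.Language.{u, v}} [L.Structure (Set.powersetCard ℕ k)]
    (hL : (∅ : Set (Set.powersetCard ℕ k)).Definable L
      {x : Fin 2 → Set.powersetCard ℕ k | (johnsonGraph k).Adj (x 0) (x 1)}) (j : ℕ) :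
    (∅ : Set (Set.powersetCard ℕ k)).Definable L
      {x : Fin 2 → Set.powersetCard ℕ k | Near j (x 0) (x 1)} := by
  have h0 : (∅ : Set (Set.powersetCard ℕ k)).Definable L
      {x : Fin 2 → Set.powersetCard ℕ k | x 0 = x 1} := Set.Definable.diagonal L ∅
  have h1 : (∅ : Set (Set.powersetCard ℕ k)).Definable L
      {x : Fin 2 → Set.powersetCard ℕ k | Near 1 (x 0) (x 1)} := by
    simp only [near_one]
    exact h0.union hL
  induction j with
  | zero => simpa only [near_zero] using h0
  | succ j ih =>
    -- Coordinate 2 is the intermediate vertex, which the projection to coordinates 0 and 1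
    -- quantifies away.
    have := ((h1.preimage_comp ![(0 : Fin 3), 2]).inter
      (ih.preimage_comp ![(2 : Fin 3), 1])).image_comp ![(0 : Fin 3), 1]
    convert this using 1
    ext x
    rw [Set.mem_ofPred_eq, near_succ]
    constructor
    · rintro ⟨U, hU⟩
      refine ⟨![x 0, x 1, U], hU, ?_⟩
      ext i : 1
      fin_cases i <;> rfl
    · rintro ⟨y, hy, rfl⟩
      exact ⟨y 2, hy⟩

/-- The negated formula is preserved as well, so preservation becomes an equivalence. -/
theorem IsModelCompleteCore.mem_iff {L : FirstOrder.Language.{u, v}} {A : Type*} [L.Structure A]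
    (hA : IsModelCompleteCore L A) {X : Set (Fin m → A)} (hX : (∅ : Set A).Definable L X)
    (e : A →[L] A) (x : Fin m → A) : e ∘ x ∈ X ↔ x ∈ X := by
  obtain ⟨φ, rfl⟩ := Set.empty_definable_iff.1 hX
  refine ⟨fun h => ?_, hA e m φ x⟩
  by_contra hx
  have := hA e m φ.not x (Formula.realize_not.2 hx)
  exact Formula.realize_not.1 this h

theorem essentiallyUnary_of_isModelCompleteCore (hk : 2 ≤ k) {L : FirstOrder.Language.{u, v}}
    [L.IsRelational] [L.Structure (Set.powersetCard ℕ k)]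
    (hL : Interdefinable L Language.graph (Set.powersetCard ℕ k))
    (hcore : IsModelCompleteCore L (Set.powersetCard ℕ k)) {n : ℕ}
    (f : Polymorphism L (Set.powersetCard ℕ k) n) : EssentiallyUnary f := by
  have hnear := definable_near (hL.2 2 adj)
  have hend : ∀ e : Set.powersetCard ℕ k →[L] Set.powersetCard ℕ k,
      ∃ h : ℕ ↪ ℕ, ∀ S, e S = Set.powersetCard.map k h S := fun e =>
    exists_eq_map_of_near (by omega) fun j S T => hcore.mem_iff (hnear j) e ![S, T]
  obtain ⟨i, h, hf⟩ := exists_eq_map_of_comp hk (f := f) fun g =>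
    hend
      { toFun := fun S => f fun i => Set.powersetCard.map k (g i) S
        map_fun' := fun F => isEmptyElim F
        map_rel' := fun {m} R x hx =>
          f.map_rel R (fun j i => Set.powersetCard.map k (g i) (x j)) fun i =>
            map_mem_of_definable (hL.1 m R) (g i) hx }
  exact ⟨i, _, hf⟩

end Definability

/-! ### Clones and collapse -/

section Clones

/-- The clone of the operations that apply an element of a monoid of self-maps to one of their
arguments. -/
def unaryClone {A : Type*} (M : Submonoid (Function.End A)) : Clone A where
  ops n := {f | ∃ i : Fin n, ∃ α ∈ M, ∀ x, f x = α (x i)}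
  proj_mem n i := ⟨i, 1, M.one_mem, fun _ => rfl⟩
  comp_mem := by
    rintro n m f g ⟨i, α, hα, hf⟩ hg
    obtain ⟨j, β, hβ, hgi⟩ := hg i
    refine ⟨j, α * β, M.mul_mem hα hβ, fun x => ?_⟩
    exact (hf _).trans (congrArg α (hgi x))

theorem Clone.subset_unary_generate {A : Type*} (S : Set (A → A)) :
    S ⊆ (Clone.generate S).unary :=
  fun _ hα _ hC => hC hα

theorem Clone.generate_ops_subset {A : Type*} {S : Set (A → A)} {C : Clone A} (hC : S ⊆ C.unary)
    (n : ℕ) : (Clone.generate S).ops n ⊆ C.ops n :=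
  fun _ hf => hf C hC

theorem Clone.comp_unary_mem {A : Type*} (C : Clone A) {n : ℕ} {α : A → A} (hα : α ∈ C.unary)
    (i : Fin n) : (fun x => α (x i)) ∈ C.ops n :=
  C.comp_mem 1 n _ (fun _ x => x i) hα fun _ => C.proj_mem n i

/-- The monoid of the self-maps of the `k`-subsets of `ℕ` that are induced by injections. -/
def injectionMonoid (k : ℕ) : Submonoid (Function.End (Set.powersetCard ℕ k)) where
  carrier := {f | ∃ h : ℕ ↪ ℕ, f = Set.powersetCard.map k h}
  one_mem' := ⟨Function.Embedding.refl ℕ, funext fun S => Subtype.ext (by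
    rw [Set.powersetCard.val_map, Finset.map_refl]; rfl)⟩
  mul_mem' := by
    rintro _ _ ⟨g, rfl⟩ ⟨h, rfl⟩
    exact ⟨h.trans g, funext fun S => Subtype.ext (Finset.map_map h g _)⟩

theorem isCollapsing_autGroup {k : ℕ} (hk : 2 ≤ k) :
    IsCollapsing (autGroup Language.graph (Set.powersetCard ℕ k)) := by
  have hmem := fun f => mem_pointwiseClosure_autGroup (k := k) (f := f) (by omega)
  intro C
  constructor
  · intro hC
    have hsub := hC.ge
    refine Clone.ext (funext fun n => (Clone.generate_ops_subset hsub n).antisymm' fun f hf => ?_)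
    obtain ⟨i, h, hfh⟩ := exists_eq_map_of_comp hk (f := f) fun g => by
      have : (fun S => f fun i => Set.powersetCard.map k (g i) S) ∈ C.unary :=
        C.comp_mem n 1 f (fun i x => Set.powersetCard.map k (g i) (x 0)) hf fun i =>
          C.comp_unary_mem (hsub ((hmem _).2 ⟨g i, rfl⟩)) 0
      rw [hC, hmem] at this
      obtain ⟨h, hh⟩ := this
      exact ⟨h, congrFun hh⟩
    rw [show f = fun x => Set.powersetCard.map k h (x i) from funext hfh]
    exact Clone.comp_unary_mem _ (Clone.subset_unary_generate _ ((hmem _).2 ⟨h, rfl⟩)) i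
  · rintro rfl
    refine Set.Subset.antisymm (fun α hα => ?_) (Clone.subset_unary_generate _)
    -- The operations that apply an injection to one argument already form a clone, so generating
    -- adds no new unary operation.
    have hsub : pointwiseClosure (autGroup Language.graph (Set.powersetCard ℕ k)) ⊆
        (unaryClone (injectionMonoid k)).unary := fun β hβ =>
      ⟨0, β, (hmem β).1 hβ, fun _ => rfl⟩
    obtain ⟨i, β, hβ, hαβ⟩ := Clone.generate_ops_subset hsub 1 hα
    have : α = β := funext fun S => hαβ fun _ => S
    rw [this]
    exact (hmem β).2 hβ

end Clones

end JohnsonCollapse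

theorem mainTheorem5 (k : ℕ) (hk : 2 ≤ k) :
    (∀ (L : FirstOrder.Language.{u, v}) [L.IsRelational] [L.Structure (Set.powersetCard ℕ k)],
      JohnsonCollapse.Interdefinable L FirstOrder.Language.graph (Set.powersetCard ℕ k) →
      JohnsonCollapse.IsModelCompleteCore L (Set.powersetCard ℕ k) →
      ∀ (n : ℕ) (f : JohnsonCollapse.Polymorphism L (Set.powersetCard ℕ k) n),
        JohnsonCollapse.EssentiallyUnary f) ∧
    JohnsonCollapse.IsCollapsing
      (JohnsonCollapse.autGroup FirstOrder.Language.graph (Set.powersetCard ℕ k)) :=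
  ⟨fun _ _ _ hL hcore _ f => JohnsonCollapse.essentiallyUnary_of_isModelCompleteCore hk hL hcore f,
    JohnsonCollapse.isCollapsing_autGroup hk⟩
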